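/- Let $p$ be a prime and $n$ a positive integer, and let $G=\mathbb{Z}_p\times\mathbb{Z}_{p^n}$, where $\mathbb{Z}_m=\mathbb{Z}/m\mathbb{Z}$. For $g=(g_1,g_2)$ and $h=(h_1,h_2)$ in $G$ put $$\langle g,h\rangle=p^{n-1}g_1h_1+g_2h_2\in\mathbb{Z}_{p^n},\qquad \chi_g(h)=e^{2\pi i\langle g,h\rangle/p^n}.$$ A subset $A\subseteq G$ is called spectral if there is a subset $B\subseteq G$ such that the functions $\chi_b$, $b\in B$, restricted to $A$, form an orthogonal basis of $L^2(A)$, the space of complex-valued functions on $A$ with the Hermitian inner product $\langle f,f'\rangle=\sum_{a\in A}f(a)\overline{f'(a)}$. A subset $A\subseteq G$ is called a tile of $G$ if there is a subset $T\subseteq G$ such that every element of $G$ can be written in exactly one way as $a+t$ with $a\in A$ and $t\in T$. Then a nonempty subset $A$ of $\mathbb{Z}_p\times\mathbb{Z}_{p^n}$ is spectral if and only if it is a tile of $\mathbb{Z}_p\times\mathbb{Z}_{p^n}$. -/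

import Mathlib

/-- The pairing `⟨u, v⟩ = p ^ (n - 1) * u₁ * v₁ + u₂ * v₂`, with values in `ℤ / p ^ n`, on the group
`ℤ / p × ℤ / p ^ n` (for `n ≥ 1`). The product `u₁ * v₁` is formed with integer representatives;
the result does not depend on their choice. -/
def pairing (p n : ℕ) (u v : ZMod p × ZMod (p ^ n)) : ZMod (p ^ n) :=
  ((p ^ (n - 1) * (u.1.val * v.1.val) : ℕ) : ZMod (p ^ n)) + u.2 * v.2

/-- The character `χ_g(h) = exp (2 π i ⟨g, h⟩ / p ^ n)` of `ℤ / p × ℤ / p ^ n`. Here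
`ZMod.stdAddChar` is the additive character `j ↦ exp (2 π i j / N)` of `ℤ / N`. -/
noncomputable def chi (p n : ℕ) [NeZero p] (g h : ZMod p × ZMod (p ^ n)) : ℂ :=
  ZMod.stdAddChar (pairing p n g h)

/-- The Hermitian inner product `⟨f, g⟩ = ∑ a ∈ A, f a * conj (g a)` on the space `L²(A)` of
complex valued functions on a finite set `A`. -/
noncomputable def l2Inner {G : Type*} {A : Finset G} (f g : A → ℂ) : ℂ :=
  ∑ a : A, f a * starRingEnd ℂ (g a)

/-- `(A, B)` is a spectral pair: the characters `χ_b`, `b ∈ B`, restricted to `A`, form an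
orthogonal basis of `L²(A)`. -/
def IsSpectralPair (p n : ℕ) [NeZero p] (A B : Finset (ZMod p × ZMod (p ^ n))) : Prop :=
  let e : B → (A → ℂ) := fun b a => chi p n b a
  (∀ b b' : B, b ≠ b' → l2Inner (e b) (e b') = 0) ∧
    LinearIndependent ℂ e ∧ Submodule.span ℂ (Set.range e) = ⊤

/-- `A` is a spectral set: it has a spectrum `B`. -/
def IsSpectral (p n : ℕ) [NeZero p] (A : Finset (ZMod p × ZMod (p ^ n))) : Prop :=
  ∃ B : Finset (ZMod p × ZMod (p ^ n)), IsSpectralPair p n A B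

/-- `A` is a tile of the group `G`: there is `T ⊆ G` such that every element of `G` has exactly one
representation `a + t` with `a ∈ A` and `t ∈ T`. -/
def IsTile {G : Type*} [AddCommGroup G] (A : Finset G) : Prop :=
  ∃ T : Finset G, ∀ g : G, ∃! x : G × G, x.1 ∈ A ∧ x.2 ∈ T ∧ x.1 + x.2 = g

/-!
By Galois conjugation the zero set `Z` of the Fourier transform of `A` is stable under
multiplication by integers prime to `p`, so it is determined by the elements `(c, p ^ k)` it
contains; `k` is called the level.

Let `S` be a set of levels and `κ` a pivot such that `Z` contains the whole of each level `k ∈ S`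
below `κ`, some `(c, p ^ κ)` if `κ ∈ S`, and `(0, p ^ k)` for `k ∈ S` above `κ`. Poisson summation
along the chain of the subgroups of elements of level at least `k`, for `k ≤ κ`, followed by the
cyclic groups generated by `(c, p ^ κ)` and by `(0, p ^ k)`, for `k > κ`, shows that `p ^ #S`
divides `#A`. If `#A = p ^ #S`, then the `p`-adic expansions supported on `S` form a spectrum of
`A`, and the expansions in the dual levels of the complement of `S` form a tiling complement.

Conversely, take for `S` the levels `k` with `(0, p ^ k) ∈ Z`, together with the pivot if needed.
For a spectral set the pivot is the first level that meets `Z` without being contained in it: the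
digits at the levels of `S`, the one at the pivot modified, separate the points of a spectrum,
whence `#A ≤ p ^ #S`. For a tile with complement `T`, the two zero sets cover all nonzero elements,
and the pivot is the first level contained in neither. It enlarges `S` for `A` or for `T`; if
`#A ≠ p ^ #S` before the enlargement, then `#A * #T = p ^ (m + 2)` rules out the latter and gives
equality in the former.
-/

open Finset

/-- The Galois group of `ℚ(ζ_N)` acts on the relations between `N`-th roots of unity. -/
theorem sum_pow_eq_zero_iff_of_coprime {ι : Type*} {s : Finset ι} {ξ : ι → ℂ} {N w : ℕ} [NeZero N]
    (hξ : ∀ i, ξ i ^ N = 1) (hw : w.Coprime N) :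
    ∑ i ∈ s, ξ i ^ w = 0 ↔ ∑ i ∈ s, ξ i = 0 := by
  have hζ := Complex.isPrimitiveRoot_exp N (NeZero.ne N)
  set ζ := Complex.exp (2 * Real.pi * Complex.I / N)
  choose e he using fun i => hζ.eq_pow_of_pow_eq_one (hξ i)
  set P : Polynomial ℤ := ∑ i ∈ s, Polynomial.X ^ e i
  have hP (k : ℕ) : Polynomial.aeval (ζ ^ k) P = ∑ i ∈ s, ξ i ^ k := by
    simp only [P, map_sum, map_pow, Polynomial.aeval_X, ← (he _).2, ← pow_mul, mul_comm]
  have hint := hζ.isIntegral (NeZero.pos N)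
  calc ∑ i ∈ s, ξ i ^ w = 0
      ↔ minpoly ℤ (ζ ^ w) ∣ P := by rw [← hP, minpoly.isIntegrallyClosed_dvd_iff (hint.pow w)]
    _ ↔ minpoly ℤ ζ ∣ P := by rw [hζ.minpoly_eq_pow_coprime hw]
    _ ↔ ∑ i ∈ s, ξ i = 0 := by
      rw [← minpoly.isIntegrallyClosed_dvd_iff hint, ← pow_one ζ, hP]
      simp only [pow_one]

section CharSum

variable {G : Type*} [AddCommGroup G] {A : Finset G} {ψ : AddChar G ℂ}

/-- The character sum `∑ a ∈ A, ψ a`, that is, the Fourier transform of the indicator function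
of `A` at `ψ`. -/
noncomputable def charSum (A : Finset G) (ψ : AddChar G ℂ) : ℂ :=
  ∑ a ∈ A, ψ a

lemma charSum_zero : charSum A 0 = #A := by
  simp [charSum]

lemma l2Inner_addChar [Finite G] (ψ ψ' : AddChar G ℂ) :
    l2Inner (fun a : A => ψ a) (fun a => ψ' a) = charSum A (ψ - ψ') := by
  rw [l2Inner, charSum, ← sum_coe_sort A]
  simp only [AddChar.sub_apply, AddChar.map_neg_eq_conj]

lemma sum_addChar_digitSum {L : Type*} [Fintype L] [DecidableEq L] (τ : L → G) (p : ℕ) :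
    ∑ d : L → Fin p, ψ (∑ l, (d l : ℕ) • τ l) = ∏ l, ∑ i ∈ range p, ψ (τ l) ^ i := by
  have hψ (d : L → Fin p) : ψ (∑ l, (d l : ℕ) • τ l) = ∏ l, ψ (τ l) ^ (d l : ℕ) := by
    simp only [← AddChar.map_nsmul_eq_pow]
    exact map_prod ψ.toMonoidHom (fun l => .ofAdd ((d l : ℕ) • τ l)) univ
  simp only [hψ, ← Fin.sum_univ_eq_sum_range, prod_univ_sum, Fintype.piFinset_univ]

variable [Finite G]

lemma charSum_nsmul_eq_zero_iff {w : ℕ} (hw : w.Coprime (Nat.card G)) :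
    charSum A (w • ψ) = 0 ↔ charSum A ψ = 0 := by
  have hψ (a : G) : ψ a ^ Nat.card G = 1 := by
    rw [← AddChar.map_nsmul_eq_pow, card_nsmul_eq_zero', AddChar.map_zero_eq_one]
  simpa only [charSum, AddChar.nsmul_apply] using sum_pow_eq_zero_iff_of_coprime hψ hw

lemma linearIndependent_of_charSum_sub_eq_zero (hA : A.Nonempty) {ι : Type*}
    {ψ : ι → AddChar G ℂ} (h : Pairwise fun i j => charSum A (ψ i - ψ j) = 0) :
    LinearIndependent ℂ fun i (a : A) => ψ i a := by
  have hinner (i j : ι) :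
      inner ℂ (WithLp.toLp 2 fun a : A => ψ i a) (WithLp.toLp 2 fun a => ψ j a) =
        charSum A (ψ j - ψ i) := by
    rw [← l2Inner_addChar]
    simp [l2Inner, PiLp.inner_apply]
  have hli : LinearIndependent ℂ fun i => WithLp.toLp 2 fun a : A => ψ i a := by
    refine linearIndependent_of_ne_zero_of_inner_eq_zero (fun i hi => ?_)
      fun i j hij => (hinner i j).trans (h hij.symm)
    have hzero := hinner i i
    rw [hi, inner_zero_left, sub_self, charSum_zero] at hzero
    exact hA.card_ne_zero (by exact_mod_cast hzero.symm)
  exact hli.map' (WithLp.linearEquiv 2 ℂ (A → ℂ)).toLinearMap (LinearEquiv.ker _)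

end CharSum

section Tiles

variable {G : Type*} [AddCommGroup G] [Fintype G] {A : Finset G}

lemma IsTile.exists_charSum_eq_zero (hA : IsTile A) :
    ∃ T : Finset G, #A * #T = Fintype.card G ∧ ∀ ψ ≠ 0, charSum A ψ = 0 ∨ charSum T ψ = 0 := by
  obtain ⟨T, hT⟩ := hA
  have hsum (f : G → ℂ) : ∑ x ∈ A ×ˢ T, f (x.1 + x.2) = ∑ g, f g := by
    refine sum_bij (fun x _ => x.1 + x.2) (fun _ _ => mem_univ _) (fun x hx y hy hxy => ?_)
      (fun g _ => ?_) (fun _ _ => rfl)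
    · rw [mem_product] at hx hy
      exact (hT _).unique ⟨hx.1, hx.2, rfl⟩ ⟨hy.1, hy.2, hxy.symm⟩
    · obtain ⟨x, ⟨hxA, hxT, hx⟩, -⟩ := hT g
      exact ⟨x, mem_product.2 ⟨hxA, hxT⟩, hx⟩
  refine ⟨T, ?_, fun ψ hψ => mul_eq_zero.1 ?_⟩
  · have hone := hsum fun _ => 1
    simp only [sum_const, card_product, card_univ, nsmul_eq_mul, mul_one] at hone
    exact_mod_cast hone
  · calc charSum A ψ * charSum T ψ
        = ∑ x ∈ A ×ˢ T, ψ (x.1 + x.2) := by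
          simp only [charSum, sum_mul_sum, sum_product, AddChar.map_add_eq_mul]
      _ = 0 := by rw [hsum, AddChar.sum_eq_zero_iff_ne_zero.2 hψ]

theorem isTile_of_charSum_mul_sum_eq_zero {J : Type*} [Fintype J] {t : J → G}
    (hcard : #A * Fintype.card J = Fintype.card G)
    (h : ∀ ψ ≠ 0, charSum A ψ * ∑ j, ψ (t j) = 0) : IsTile A := by
  classical
  have hone (g : G) : #{x ∈ A ×ˢ (univ : Finset J) | x.1 + t x.2 = g} = 1 := by
    have hdual : ∑ x ∈ A ×ˢ (univ : Finset J), ∑ ψ : AddChar G ℂ, ψ (x.1 + t x.2 - g) =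
        #{x ∈ A ×ˢ (univ : Finset J) | x.1 + t x.2 = g} * Fintype.card G := by
      simp only [AddChar.sum_apply_eq_ite, sub_eq_zero]
      rw [← sum_filter, sum_const, nsmul_eq_mul]
    have hprim (ψ : AddChar G ℂ) : ∑ x ∈ A ×ˢ (univ : Finset J), ψ (x.1 + t x.2 - g) =
        ψ (-g) * (charSum A ψ * ∑ j, ψ (t j)) := by
      rw [charSum, sum_mul_sum, ← sum_product', mul_sum]
      simp only [sub_eq_add_neg, AddChar.map_add_eq_mul, mul_comm (ψ (-g))]
    rw [sum_comm, sum_eq_single 0 (fun ψ _ hψ => by rw [hprim, h ψ hψ, mul_zero]) (by simp),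
      hprim, charSum_zero] at hdual
    have hG : (Fintype.card G : ℂ) ≠ 0 := by exact_mod_cast Fintype.card_ne_zero
    have hmul : (#A : ℂ) * Fintype.card J = Fintype.card G := by exact_mod_cast hcard
    simp only [AddChar.zero_apply, sum_const, card_univ, nsmul_eq_mul, mul_one, one_mul,
      hmul] at hdual
    exact_mod_cast (mul_right_cancel₀ hG ((one_mul _).trans hdual)).symm
  refine ⟨univ.image t, fun g => ?_⟩
  obtain ⟨x, hx⟩ := card_eq_one.1 (hone g)
  have hmem (a : G) (j : J) : a ∈ A ∧ a + t j = g ↔ (a, j) = x := by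
    rw [← mem_singleton (a := x), ← hx, mem_filter, mem_product]
    simp only [mem_univ, and_true]
  obtain ⟨hxA, hxg⟩ := (hmem x.1 x.2).2 rfl
  refine ⟨(x.1, t x.2), ⟨hxA, mem_image_of_mem t (mem_univ _), hxg⟩, ?_⟩
  rintro ⟨a, b⟩ ⟨ha, hb, hab⟩
  obtain ⟨j, -, rfl⟩ := mem_image.1 hb
  rw [← (hmem a j).1 ⟨ha, hab⟩]

lemma isTile_of_digitSum {p : ℕ} (hp : 1 < p) {L : Type*} [Fintype L] (τ : L → G)
    (hcard : #A * p ^ Fintype.card L = Fintype.card G)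
    (h : ∀ ψ ≠ 0, charSum A ψ = 0 ∨ ∃ l, IsPrimitiveRoot (ψ (τ l)) p) : IsTile A := by
  classical
  refine isTile_of_charSum_mul_sum_eq_zero (t := fun d : L → Fin p => ∑ l, (d l : ℕ) • τ l)
    (by rwa [Fintype.card_fun, Fintype.card_fin]) fun ψ hψ => ?_
  rcases h ψ hψ with hA | ⟨l, hl⟩
  · rw [hA, zero_mul]
  · rw [sum_addChar_digitSum, prod_eq_zero (mem_univ l) (hl.geom_sum_eq_zero hp), mul_zero]

end Tiles

section FiberDvd

variable {G : Type*} [AddCommGroup G] {A : Finset G} {K K' : AddSubgroup (AddChar G ℂ)} {q : ℕ}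

/-- The part of `A` in the coset of the annihilator of `K` through `g`. -/
noncomputable def dualFiber (A : Finset G) (K : AddSubgroup (AddChar G ℂ)) (g : G) : Finset G :=
  open Classical in {a ∈ A | ∀ ψ ∈ K, ψ a = ψ g}

/-- `q` divides the number of points of `A` in each coset of the annihilator of `K`. -/
def FiberDvd (A : Finset G) (K : AddSubgroup (AddChar G ℂ)) (q : ℕ) : Prop :=
  ∀ g, q ∣ #(dualFiber A K g)

lemma mem_dualFiber {a g : G} : a ∈ dualFiber A K g ↔ a ∈ A ∧ ∀ ψ ∈ K, ψ a = ψ g := by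
  simp [dualFiber]

lemma fiberDvd_one : FiberDvd A K 1 := fun _ => one_dvd _

lemma FiberDvd.dvd_card (h : FiberDvd A ⊥ q) : q ∣ #A := by
  have hA : dualFiber A ⊥ 0 = A := by
    ext a
    simp [mem_dualFiber]
  simpa only [hA] using h 0

lemma FiberDvd.mono (h : FiberDvd A K q) (hK : K' ≤ K) : FiberDvd A K' q := by
  classical
  intro g
  have hfib : ∀ a ∈ dualFiber A K' g,
      {x ∈ dualFiber A K' g | (fun ψ : K => (ψ : AddChar G ℂ) x) = fun ψ : K => ψ.1 a} =
        dualFiber A K a := by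
    intro a ha
    rw [mem_dualFiber] at ha
    ext x
    simp only [mem_filter, mem_dualFiber, funext_iff, Subtype.forall, and_assoc,
      and_congr_right_iff, and_iff_right_iff_imp]
    intro _ hx ψ hψ
    rw [hx ψ (hK hψ), ha.2 ψ hψ]
  rw [card_eq_sum_card_image fun (a : G) (ψ : K) => (ψ : AddChar G ℂ) a]
  refine dvd_sum fun f hf => ?_
  obtain ⟨a, ha, rfl⟩ := mem_image.1 hf
  rw [hfib a ha]
  exact h a

/-- Poisson summation for the annihilator of `K`. -/
lemma natCard_mul_card_dualFiber [Fintype (AddChar G ℂ)] [DecidablePred (· ∈ K)] (A : Finset G)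
    (g : G) :
    (Nat.card K * #(dualFiber A K g) : ℂ) = ∑ ψ with ψ ∈ K, ψ (-g) * charSum A ψ := by
  classical
  have horth (x : G) : ∑ ψ with ψ ∈ K, ψ x = if ∀ ψ ∈ K, ψ x = 1 then (Nat.card K : ℂ) else 0 := by
    have h := AddChar.sum_eq_ite ((AddChar.doubleDualEmb x).compAddMonoidHom K.subtype)
    rw [sum_subtype _ (p := (· ∈ K)) (fun ψ => by simp), Nat.card_eq_fintype_card]
    simpa only [DFunLike.ext_iff, AddChar.compAddMonoidHom_apply, AddSubgroup.subtype_apply,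
      AddChar.doubleDualEmb_apply, AddChar.zero_apply, Subtype.forall] using h
  have hshift (ψ : AddChar G ℂ) (a : G) : ψ (-g + a) = 1 ↔ ψ a = ψ g := by
    rw [AddChar.map_add_eq_mul, AddChar.map_neg_eq_inv, inv_mul_eq_one₀ (ψ.val_isUnit g).ne_zero,
      eq_comm]
  calc (Nat.card K * #(dualFiber A K g) : ℂ)
      = ∑ a ∈ A, ∑ ψ with ψ ∈ K, ψ (-g + a) := by
        simp only [horth, hshift, ← sum_filter, sum_const, nsmul_eq_mul, dualFiber, mul_comm]
        congr!
    _ = ∑ ψ with ψ ∈ K, ψ (-g) * charSum A ψ := by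
        rw [sum_comm]
        simp only [AddChar.map_add_eq_mul, charSum, mul_sum]

lemma FiberDvd.mul_of_charSum_eq_zero [Finite G] {p : ℕ} (h : FiberDvd A K q) (hK : K' ≤ K)
    (hcard : Nat.card K = p * Nat.card K') (hA : ∀ ψ ∈ K, ψ ∉ K' → charSum A ψ = 0) :
    FiberDvd A K' (p * q) := by
  classical
  have := Fintype.ofFinite (AddChar G ℂ)
  intro g
  have hmul : Nat.card K' * (p * #(dualFiber A K g)) = Nat.card K' * #(dualFiber A K' g) := by
    rw [← mul_assoc, mul_comm _ p, ← hcard]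
    suffices (Nat.card K * #(dualFiber A K g) : ℂ) = Nat.card K' * #(dualFiber A K' g) by
      exact_mod_cast this
    rw [natCard_mul_card_dualFiber, natCard_mul_card_dualFiber]
    refine (sum_subset (fun ψ => ?_) fun ψ hψ hψ' => ?_).symm
    · simpa only [mem_filter_univ] using @hK ψ
    · rw [mem_filter_univ] at hψ hψ'
      rw [hA ψ hψ hψ', mul_zero]
  rw [← Nat.eq_of_mul_eq_mul_left Nat.card_pos hmul]
  exact mul_dvd_mul_left p (h g)

lemma FiberDvd.zmultiples_nsmul [Finite G] {p k : ℕ} [hp : Fact p.Prime] (hG : Nat.card G = p ^ k)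
    {ψ : AddChar G ℂ} (h : FiberDvd A (.zmultiples ψ) q) (hA : charSum A ψ = 0) :
    FiberDvd A (.zmultiples (p • ψ)) (p * q) := by
  rcases eq_or_ne ψ 0 with rfl | hψ
  · rw [charSum_zero, Nat.cast_eq_zero, card_eq_zero] at hA
    intro g
    simp [hA, dualFiber]
  have hpow : p ^ k • ψ = 0 := by
    ext a
    rw [AddChar.nsmul_apply, ← AddChar.map_nsmul_eq_pow, ← hG, card_nsmul_eq_zero',
      AddChar.map_zero_eq_one, AddChar.zero_apply]
  have hdvd : p ∣ addOrderOf ψ := by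
    obtain ⟨j, -, hj⟩ := (Nat.dvd_prime_pow hp.out).1 (addOrderOf_dvd_of_nsmul_eq_zero hpow)
    rw [hj]
    refine dvd_pow_self p fun hj0 => hψ ?_
    rwa [hj0, pow_zero, AddMonoid.addOrderOf_eq_one_iff] at hj
  refine h.mul_of_charSum_eq_zero ?_ ?_ fun χ hχ hχ' => ?_
  · exact AddSubgroup.zmultiples_le_of_mem (AddSubgroup.nsmul_mem_zmultiples ψ p)
  · rw [Nat.card_zmultiples, Nat.card_zmultiples, addOrderOf_nsmul_of_dvd hp.out.ne_zero hdvd,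
      Nat.mul_div_cancel' hdvd]
  · obtain ⟨w, rfl⟩ := mem_multiples_iff_mem_zmultiples.2 hχ
    have hw : ¬ p ∣ w := by
      rintro ⟨v, rfl⟩
      exact hχ' ⟨v, by simp only [natCast_zsmul, mul_nsmul]⟩
    refine (charSum_nsmul_eq_zero_iff ?_).2 hA
    rw [hG]
    exact (((Nat.Prime.coprime_iff_not_dvd hp.out).2 hw).symm.pow_right k)

end FiberDvd

section ZModPair

lemma stdAddChar_pow_mul_natCast {p : ℕ} [NeZero p] (m k : ℕ) :
    (ZMod.stdAddChar ((p ^ m * k : ℕ) : ZMod (p ^ (m + 1))) : ℂ) =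
      ZMod.stdAddChar (k : ZMod p) := by
  have hp : (p : ℂ) ≠ 0 := NeZero.ne _
  rw [← Int.cast_natCast, ← Int.cast_natCast k, ZMod.stdAddChar_coe, ZMod.stdAddChar_coe]
  congr 1
  push_cast
  field_simp
  ring

lemma isPrimitiveRoot_stdAddChar {p : ℕ} [hp : Fact p.Prime] {x : ZMod p} (hx : x ≠ 0) :
    IsPrimitiveRoot (ZMod.stdAddChar x : ℂ) p := by
  have hpow : (ZMod.stdAddChar x : ℂ) ^ p = 1 := by
    rw [← AddChar.map_nsmul_eq_pow, nsmul_eq_mul, ZMod.natCast_self, zero_mul,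
      AddChar.map_zero_eq_one]
  have hne : (ZMod.stdAddChar x : ℂ) ≠ 1 := by
    rw [← AddChar.map_zero_eq_one (ZMod.stdAddChar (N := p))]
    exact ZMod.injective_stdAddChar.ne hx
  exact IsPrimitiveRoot.iff_orderOf.2 (orderOf_eq_prime hpow hne)

/-- The group `ℤ / p × ℤ / p ^ (m + 1)`. -/
abbrev ZModPair (p m : ℕ) : Type := ZMod p × ZMod (p ^ (m + 1))

lemma natCard_zModPair (p m : ℕ) : Nat.card (ZModPair p m) = p ^ (m + 2) := by
  simp only [Nat.card_prod, Nat.card_zmod]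
  ring

variable {p m : ℕ} [Fact p.Prime]

lemma chi_eq_stdAddChar_mul (b a : ZModPair p m) :
    chi p (m + 1) b a = ZMod.stdAddChar (b.1 * a.1) * ZMod.stdAddChar (b.2 * a.2) := by
  rw [chi, pairing, AddChar.map_add_eq_mul, Nat.add_sub_cancel, stdAddChar_pow_mul_natCast,
    Nat.cast_mul, ZMod.natCast_zmod_val, ZMod.natCast_zmod_val]

/-- The homomorphism `b ↦ χ_b` from `ℤ / p × ℤ / p ^ (m + 1)` to its dual group. -/
noncomputable def chiHom : ZModPair p m →+ AddChar (ZModPair p m) ℂ :=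
  AddMonoidHom.mk'
    (fun b =>
      { toFun := chi p (m + 1) b
        map_zero_eq_one' := by simp [chi_eq_stdAddChar_mul]
        map_add_eq_mul' := fun a a' => by
          simp only [chi_eq_stdAddChar_mul, Prod.fst_add, Prod.snd_add, mul_add,
            AddChar.map_add_eq_mul]
          ring })
    fun b b' => by
      ext a
      simp only [AddChar.add_apply, AddChar.coe_mk, chi_eq_stdAddChar_mul, Prod.fst_add,
        Prod.snd_add, add_mul, AddChar.map_add_eq_mul]
      ring

lemma chiHom_apply (b a : ZModPair p m) :
    chiHom b a = ZMod.stdAddChar (b.1 * a.1) * ZMod.stdAddChar (b.2 * a.2) :=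
  chi_eq_stdAddChar_mul b a

lemma chiHom_injective : Function.Injective (chiHom (p := p) (m := m)) := by
  refine (injective_iff_map_eq_zero _).2 fun b hb => ?_
  have heval (a : ZModPair p m) := DFunLike.congr_fun hb a
  simp only [chiHom_apply, AddChar.zero_apply] at heval
  ext
  · refine ZMod.injective_stdAddChar ?_
    simpa using heval (1, 0)
  · refine ZMod.injective_stdAddChar ?_
    simpa using heval (0, 1)

lemma chiHom_surjective : Function.Surjective (chiHom (p := p) (m := m)) :=
  ((Fintype.bijective_iff_injective_and_card _).2 ⟨chiHom_injective, AddChar.card_eq.symm⟩).2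

variable {A : Finset (ZModPair p m)} {g : ZModPair p m}

/-- The zero set of the Fourier transform of the indicator function of `A`. -/
def zeroSet (A : Finset (ZModPair p m)) : Set (ZModPair p m) :=
  {g | charSum A (chiHom g) = 0}

lemma mem_zeroSet : g ∈ zeroSet A ↔ charSum A (chiHom g) = 0 := Iff.rfl

lemma zero_notMem_zeroSet (hA : A.Nonempty) : 0 ∉ zeroSet A := by
  rw [mem_zeroSet, map_zero, charSum_zero]
  exact_mod_cast hA.card_ne_zero

lemma nsmul_mem_zeroSet_iff {w : ℕ} (hw : (w : ZMod p) ≠ 0) :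
    w • g ∈ zeroSet A ↔ g ∈ zeroSet A := by
  rw [Ne, ZMod.natCast_eq_zero_iff, ← (Fact.out : p.Prime).coprime_iff_not_dvd] at hw
  rw [mem_zeroSet, map_nsmul]
  exact charSum_nsmul_eq_zero_iff (natCard_zModPair p m ▸ hw.symm.pow_right _)

lemma isSpectral_iff (hA : A.Nonempty) :
    IsSpectral p (m + 1) A ↔ ∃ B : Finset (ZModPair p m), #B = #A ∧
      ∀ b ∈ B, ∀ b' ∈ B, b ≠ b' → b - b' ∈ zeroSet A := by
  have hinner (b b' : ZModPair p m) :
      l2Inner (fun a : A => chi p (m + 1) b a) (fun a => chi p (m + 1) b' a) = 0 ↔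
        b - b' ∈ zeroSet A := by
    rw [mem_zeroSet, map_sub, ← l2Inner_addChar]
    rfl
  refine exists_congr fun B => ⟨fun ⟨horth, hli, hspan⟩ => ⟨?_, fun b hb b' hb' hne => ?_⟩,
    fun ⟨hcard, hB⟩ => ?_⟩
  · simpa using (Module.finrank_eq_card_basis (.mk hli hspan.ge)).symm
  · exact (hinner b b').1 (horth ⟨b, hb⟩ ⟨b', hb'⟩ (by simpa using hne))
  · have horth (b b' : B) (hne : b ≠ b') : (b - b' : ZModPair p m) ∈ zeroSet A :=
      hB b b.2 b' b'.2 (Subtype.coe_injective.ne hne)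
    have hli : LinearIndependent ℂ fun (b : B) (a : A) => chi p (m + 1) b a :=
      linearIndependent_of_charSum_sub_eq_zero (ψ := fun b : B => chiHom b.1) hA
        fun b b' hne => by simpa only [mem_zeroSet, map_sub] using horth b b' hne
    exact ⟨fun b b' hne => (hinner b b').2 (horth b b' hne), hli,
      hli.span_eq_top_of_card_eq_finrank' (by simp [hcard])⟩

end ZModPair

section Levels

variable {p m : ℕ}

/-- Reduction modulo `p` on `ℤ / p ^ (m + 1)`. -/
def residue : ZMod (p ^ (m + 1)) →+* ZMod p :=
  ZMod.castHom (dvd_pow_self p m.succ_ne_zero) (ZMod p)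

/-- The element of level `k` with first coordinate `c`. For `c ≠ 0` the levels run up to `m + 1`,
and `freq c (m + 1) = (c, 0)`. -/
def freq (c : ZMod p) (k : ℕ) : ZModPair p m :=
  (c, p ^ k)

lemma natCast_pow_eq_zero {k : ℕ} (hk : m < k) : (p : ZMod (p ^ (m + 1))) ^ k = 0 := by
  rw [← Nat.cast_pow, ZMod.natCast_eq_zero_iff]
  exact pow_dvd_pow p hk

variable [hp : Fact p.Prime] {A : Finset (ZModPair p m)} {k : ℕ} {c d x : ZMod p}
  {u : ZMod (p ^ (m + 1))}

lemma natCast_val_eq_residue (u : ZMod (p ^ (m + 1))) : (u.val : ZMod p) = residue u := by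
  rw [residue, ZMod.castHom_apply, ZMod.natCast_val]

lemma dvd_of_residue_eq_zero (hu : residue u = 0) : (p : ZMod (p ^ (m + 1))) ∣ u := by
  rw [← natCast_val_eq_residue, ZMod.natCast_eq_zero_iff] at hu
  simpa only [ZMod.natCast_zmod_val] using Nat.cast_dvd_cast (α := ZMod (p ^ (m + 1))) hu

lemma exists_eq_mul_pow (s : ZMod (p ^ (m + 1))) :
    ∃ k ≤ m + 1, ∃ u : ZMod (p ^ (m + 1)), residue u ≠ 0 ∧ s = u * p ^ k := by
  rcases eq_or_ne s 0 with rfl | hs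
  · exact ⟨m + 1, le_rfl, 1, by simp, by rw [natCast_pow_eq_zero m.lt_succ_self, mul_zero]⟩
  · have hs' : s.val ≠ 0 := by rwa [Ne, ZMod.val_eq_zero]
    obtain ⟨k, v, hv, hsv⟩ := Nat.exists_eq_pow_mul_and_not_dvd hs' p hp.out.ne_one
    refine ⟨k, ?_, v, ?_, ?_⟩
    · have hlt := (Nat.le_of_dvd (Nat.pos_of_ne_zero hs') ⟨v, hsv⟩).trans_lt s.val_lt
      exact ((Nat.pow_lt_pow_iff_right hp.out.one_lt).1 hlt).le
    · rwa [map_natCast, Ne, ZMod.natCast_eq_zero_iff]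
    · rw [← ZMod.natCast_zmod_val s, hsv, mul_comm]
      push_cast
      rfl

lemma mk_mul_pow_mem_zeroSet_iff (hu : residue u ≠ 0) :
    (x, u * p ^ k) ∈ zeroSet A ↔ freq (x / residue u) k ∈ zeroSet A := by
  have hval : (u.val : ZMod p) ≠ 0 := by rwa [natCast_val_eq_residue]
  have hsmul : (x, u * p ^ k) = u.val • freq (x / residue u) k := by
    ext
    · rw [Prod.smul_fst, nsmul_eq_mul, natCast_val_eq_residue, freq, mul_div_cancel₀ _ hu]
    · rw [Prod.smul_snd, nsmul_eq_mul, ZMod.natCast_zmod_val, freq]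
  rw [hsmul, nsmul_mem_zeroSet_iff hval]

lemma freq_last_mem_zeroSet_iff (hc : c ≠ 0) (hd : d ≠ 0) (hk : m < k) :
    freq c k ∈ zeroSet A ↔ freq d k ∈ zeroSet A := by
  have hcd : ((c / d).val : ZMod p) ≠ 0 := by
    rw [ZMod.natCast_zmod_val]
    exact div_ne_zero hc hd
  have hsmul : freq c k = (c / d).val • freq (m := m) d k := by
    ext
    · rw [Prod.smul_fst, nsmul_eq_mul, ZMod.natCast_zmod_val, freq, freq, div_mul_cancel₀ _ hd]
    · rw [Prod.smul_snd, freq, freq, natCast_pow_eq_zero hk, smul_zero]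
  rw [hsmul, nsmul_mem_zeroSet_iff hcd]

lemma zero_freq_notMem_zeroSet (hA : A.Nonempty) (hk : m < k) : freq 0 k ∉ zeroSet A := by
  rw [freq, natCast_pow_eq_zero hk]
  exact zero_notMem_zeroSet hA

end Levels

/-- All elements of level `k` are zeros of the Fourier transform of `A`. -/
def IsFullLevel {p m : ℕ} [Fact p.Prime] (A : Finset (ZModPair p m)) (k : ℕ) : Prop :=
  ∀ d, freq d k ∈ zeroSet A

/-- A digit system for `A` is a set `S` of levels on which the zero set of `A` is large enough for
`p`-adic expansions supported on `S` to be both a spectrum of `A` and a bound for `#A`. All elements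
of a level `k ∈ S` below the pivot level `κ` are zeros; at the pivot level the zero required is
`(c, p ^ κ)`, and above it `(0, p ^ k)`. -/
structure IsDigitSystem {p m : ℕ} [Fact p.Prime] (A : Finset (ZModPair p m)) (S : Finset ℕ) (κ : ℕ)
    (c : ZMod p) : Prop where
  subset : S ⊆ range (m + 2)
  pivot_le : κ ≤ m + 1
  below : ∀ k ∈ S, k < κ → IsFullLevel A k
  pivot : κ ∈ S → freq c κ ∈ zeroSet A
  above : ∀ k ∈ S, κ < k → freq 0 k ∈ zeroSet A

/-- `A` has a digit system whose digit expansions are as numerous as the elements of `A`. -/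
def HasDigitSystem {p m : ℕ} [Fact p.Prime] (A : Finset (ZModPair p m)) : Prop :=
  ∃ S κ c, IsDigitSystem A S κ c ∧ #A = p ^ #S

section Divisibility

variable {p m : ℕ} [hp : Fact p.Prime] {A : Finset (ZModPair p m)} {i k q : ℕ}

lemma nsmul_freq (c : ZMod p) (k : ℕ) : p • freq (m := m) c k = freq 0 (k + 1) := by
  ext <;> simp [freq, pow_succ']

lemma addOrderOf_natCast_pow (hk : k ≤ m) :
    addOrderOf ((p : ZMod (p ^ (m + 1))) ^ k) =
      p * addOrderOf ((p : ZMod (p ^ (m + 1))) ^ (k + 1)) := by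
  have h (j : ℕ) (hj : j ≤ m + 1) :
      addOrderOf ((p : ZMod (p ^ (m + 1))) ^ j) = p ^ (m + 1 - j) := by
    rw [← Nat.cast_pow, ZMod.addOrderOf_coe _ (NeZero.ne _),
      Nat.gcd_eq_right (pow_dvd_pow p hj), Nat.pow_div hj hp.out.pos]
  rw [h k (by lia), h (k + 1) (by lia), ← pow_succ']
  congr 1
  lia

/-- The characters of level at least `k`. -/
noncomputable def levelChars (p m k : ℕ) [Fact p.Prime] : AddSubgroup (AddChar (ZModPair p m) ℂ) :=
  ((⊤ : AddSubgroup (ZMod p)).prod (.zmultiples ((p : ZMod (p ^ (m + 1))) ^ k))).map chiHom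

lemma natCard_levelChars :
    Nat.card (levelChars p m k) = p * addOrderOf ((p : ZMod (p ^ (m + 1))) ^ k) := by
  rw [levelChars, AddSubgroup.card_map_of_injective chiHom_injective,
    Nat.card_congr (AddSubgroup.prodEquiv _ _).toEquiv, Nat.card_prod, AddSubgroup.card_top,
    Nat.card_zmod, Nat.card_zmultiples]

lemma chiHom_mem_levelChars {g : ZModPair p m} :
    chiHom g ∈ levelChars p m k ↔ (p : ZMod (p ^ (m + 1))) ^ k ∣ g.2 := by
  rw [levelChars, AddSubgroup.mem_map_iff_mem chiHom_injective, AddSubgroup.mem_prod,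
    AddSubgroup.mem_zmultiples_iff]
  refine ⟨fun ⟨_, w, hw⟩ => ⟨w, by rw [← hw, zsmul_eq_mul, mul_comm]⟩, fun ⟨u, hu⟩ =>
    ⟨AddSubgroup.mem_top _, u.val, ?_⟩⟩
  rw [hu, zsmul_eq_mul, Int.cast_natCast, ZMod.natCast_zmod_val, mul_comm]

lemma levelChars_succ_le (k : ℕ) : levelChars p m (k + 1) ≤ levelChars p m k := by
  intro ψ hψ
  obtain ⟨g, rfl⟩ := chiHom_surjective ψ
  rw [chiHom_mem_levelChars] at hψ ⊢
  exact (pow_dvd_pow _ k.le_succ).trans hψ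

lemma FiberDvd.levelChars_succ (hk : k ≤ m) (h : FiberDvd A (levelChars p m k) q)
    (hA : IsFullLevel A k) : FiberDvd A (levelChars p m (k + 1)) (p * q) := by
  refine h.mul_of_charSum_eq_zero (levelChars_succ_le k) ?_ fun ψ hψ hψ' => ?_
  · rw [natCard_levelChars, natCard_levelChars, addOrderOf_natCast_pow hk]
  · obtain ⟨⟨x, s⟩, rfl⟩ := chiHom_surjective ψ
    rw [chiHom_mem_levelChars] at hψ hψ'
    obtain ⟨u, rfl : s = p ^ k * u⟩ := hψ
    have hu : residue u ≠ 0 := fun hu =>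
      hψ' (pow_succ (p : ZMod (p ^ (m + 1))) k ▸ mul_dvd_mul_left _ (dvd_of_residue_eq_zero hu))
    rw [← mem_zeroSet, mul_comm, mk_mul_pow_mem_zeroSet_iff hu]
    exact hA _

lemma FiberDvd.zmultiples_freq_succ {c : ZMod p}
    (h : FiberDvd A (.zmultiples (chiHom (freq c k))) q) (hA : freq c k ∈ zeroSet A) :
    FiberDvd A (.zmultiples (chiHom (freq 0 (k + 1)))) (p * q) := by
  rw [← nsmul_freq c, map_nsmul]
  exact h.zmultiples_nsmul (natCard_zModPair p m) hA

lemma zmultiples_freq_succ_le (c : ZMod p) (k : ℕ) :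
    AddSubgroup.zmultiples (chiHom (freq (m := m) 0 (k + 1))) ≤
      .zmultiples (chiHom (freq c k)) := by
  rw [← nsmul_freq c, map_nsmul]
  exact AddSubgroup.zmultiples_le_of_mem (AddSubgroup.nsmul_mem_zmultiples _ p)

namespace IsDigitSystem

variable {S : Finset ℕ} {κ : ℕ} {c : ZMod p}

lemma fiberDvd_levelChars (hS : IsDigitSystem A S κ c) (hi : i ≤ κ) :
    FiberDvd A (levelChars p m i) (p ^ i.count (· ∈ S)) := by
  induction i with
  | zero => exact fiberDvd_one
  | succ i ih =>
    have ih := ih (by lia)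
    rw [Nat.count_succ]
    split_ifs with hiS
    · rw [pow_succ' p (i.count _)]
      exact ih.levelChars_succ (by have := hS.pivot_le; lia) (hS.below i hiS hi)
    · exact ih.mono (levelChars_succ_le i)

lemma fiberDvd_zmultiples (hS : IsDigitSystem A S κ c) (hi : κ < i) :
    FiberDvd A (.zmultiples (chiHom (freq 0 i))) (p ^ i.count (· ∈ S)) := by
  induction i, hi using Nat.le_induction with
  | base =>
    have h := (hS.fiberDvd_levelChars le_rfl).mono (K' := .zmultiples (chiHom (freq c κ)))
      (AddSubgroup.zmultiples_le_of_mem (chiHom_mem_levelChars.2 (dvd_refl _)))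
    rw [Nat.succ_eq_add_one, Nat.count_succ]
    split_ifs with hκ
    · rw [pow_succ' p (κ.count _)]
      exact h.zmultiples_freq_succ (hS.pivot hκ)
    · exact h.mono (zmultiples_freq_succ_le c κ)
  | succ i hi ih =>
    rw [Nat.count_succ]
    split_ifs with hiS
    · rw [pow_succ' p (i.count _)]
      exact ih.zmultiples_freq_succ (hS.above i hiS hi)
    · exact ih.mono (zmultiples_freq_succ_le 0 i)

theorem pow_card_dvd (hS : IsDigitSystem A S κ c) : p ^ #S ∣ #A := by
  have hcount : (m + 2).count (· ∈ S) = #S := by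
    rw [Nat.count_eq_card_filter_range, filter_mem_eq_inter, inter_eq_right.2 hS.subset]
  have h := hS.fiberDvd_zmultiples (i := m + 2) (by have := hS.pivot_le; lia)
  have hzero : freq (p := p) (m := m) 0 (m + 2) = 0 := by
    rw [freq, natCast_pow_eq_zero (by lia)]
    rfl
  rw [hcount, hzero, map_zero, AddSubgroup.zmultiples_zero_eq_bot] at h
  exact h.dvd_card

lemma card_le_of_card_eq_pow (hS : IsDigitSystem A S κ c) {s : ℕ} (hs : #A = p ^ s) : #S ≤ s :=
  (Nat.pow_dvd_pow_iff_le_right hp.out.one_lt).1 (hs ▸ hS.pow_card_dvd)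

end IsDigitSystem

end Divisibility

section OfIsDigitSystem

variable {p m : ℕ} [hp : Fact p.Prime] {A : Finset (ZModPair p m)} {S : Finset ℕ} {k κ : ℕ}
  {c : ZMod p}

lemma exists_sum_mul_pow_eq_mul_pow (e : S → ZMod (p ^ (m + 1))) (k : S) (he : ∀ i < k, e i = 0) :
    ∃ u : ZMod (p ^ (m + 1)), residue u = residue (e k) ∧
      ∑ i, e i * p ^ (i : ℕ) = u * p ^ (k : ℕ) := by
  refine ⟨∑ i, e i * p ^ (i - k : ℕ), ?_, ?_⟩
  · rw [map_sum, sum_eq_single k (fun i _ hik => ?_) (by simp)]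
    · simp
    · rcases lt_or_gt_of_ne hik with hlt | hlt
      · rw [he i hlt, zero_mul, map_zero]
      · rw [map_mul, map_pow, map_natCast, ZMod.natCast_self,
          zero_pow (Nat.sub_ne_zero_of_lt hlt), mul_zero]
  · rw [sum_mul]
    refine sum_congr rfl fun i _ => ?_
    rcases lt_or_ge i k with hlt | hle
    · rw [he i hlt, zero_mul, zero_mul, zero_mul]
    · rw [mul_assoc, ← pow_add, Nat.sub_add_cancel hle]

/-- The element with `p`-adic digits `d`, tilted by `c` at the pivot level `κ`. -/
def digitExpansion (κ : ℕ) (c : ZMod p) (d : S → ZMod p) : ZModPair p m :=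
  ∑ k, (d k).val • freq (if (k : ℕ) = κ then c else 0) k

lemma digitExpansion_sub (d d' : S → ZMod p) :
    digitExpansion (m := m) κ c d - digitExpansion κ c d' =
      (∑ k, (d k - d' k) * (if (k : ℕ) = κ then c else 0),
        ∑ k, ((d k).val - (d' k).val : ZMod (p ^ (m + 1))) * p ^ (k : ℕ)) := by
  ext
  · simp only [digitExpansion, freq, Prod.fst_sub, Prod.fst_sum, nsmul_eq_mul, Prod.fst_mul,
      Prod.fst_natCast, ZMod.natCast_zmod_val, sub_mul, sum_sub_distrib]
  · simp only [digitExpansion, freq, Prod.snd_sub, Prod.snd_sum, nsmul_eq_mul, Prod.snd_mul,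
      Prod.snd_natCast, sub_mul, sum_sub_distrib]

lemma IsDigitSystem.digitExpansion_sub_mem_zeroSet (hS : IsDigitSystem A S κ c)
    {d d' : S → ZMod p} (hne : d ≠ d') :
    digitExpansion κ c d - digitExpansion κ c d' ∈ zeroSet A := by
  obtain ⟨k, hk, hmin⟩ := wellFounded_lt.has_min {k | d k ≠ d' k} (Function.ne_iff.1 hne)
  have heq (i : S) (hi : i < k) : d i = d' i := not_not.1 fun h => hmin i h hi
  obtain ⟨u, hu, hsum⟩ := exists_sum_mul_pow_eq_mul_pow (m := m)
    (fun i : S => ((d i).val - (d' i).val : ZMod (p ^ (m + 1)))) k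
    fun i hi => by rw [heq i hi, sub_self]
  rw [map_sub, map_natCast, map_natCast, ZMod.natCast_zmod_val, ZMod.natCast_zmod_val] at hu
  have hu0 : residue u ≠ 0 := hu ▸ sub_ne_zero.2 hk
  rw [digitExpansion_sub, hsum, mk_mul_pow_mem_zeroSet_iff hu0]
  rcases lt_trichotomy (k : ℕ) κ with hlt | rfl | hlt
  · exact hS.below k k.2 hlt _
  · rw [sum_eq_single k (fun i _ hi => by rw [if_neg (Subtype.coe_injective.ne hi), mul_zero])
      (by simp), if_pos rfl, ← hu, mul_div_cancel_left₀ _ hu0]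
    exact hS.pivot k.2
  · rw [sum_eq_zero, zero_div]
    · exact hS.above k k.2 hlt
    · intro i _
      split_ifs with hi
      · rw [heq i (by rw [← Subtype.coe_lt_coe, hi]; exact hlt), sub_self, zero_mul]
      · rw [mul_zero]

theorem HasDigitSystem.isSpectral (hA : A.Nonempty) (h : HasDigitSystem A) :
    IsSpectral p (m + 1) A := by
  obtain ⟨S, κ, c, hS, hcard⟩ := h
  have hinj : Function.Injective (digitExpansion (S := S) (m := m) κ c) := by
    intro d d' hdd
    by_contra hne
    have := hS.digitExpansion_sub_mem_zeroSet hne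
    rw [hdd, sub_self] at this
    exact zero_notMem_zeroSet hA this
  refine (isSpectral_iff hA).2 ⟨univ.image (digitExpansion (S := S) κ c), ?_, ?_⟩
  · rw [card_image_of_injective _ hinj, card_univ, Fintype.card_fun, ZMod.card, Fintype.card_coe,
      hcard]
  · simp only [forall_mem_image, mem_univ, forall_const]
    exact fun d d' hne => hS.digitExpansion_sub_mem_zeroSet fun h => hne (h ▸ rfl)

lemma stdAddChar_mul_pow (u : ZMod (p ^ (m + 1))) :
    (ZMod.stdAddChar (N := p ^ (m + 1)) (u * p ^ m) : ℂ) = ZMod.stdAddChar (residue u) := by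
  rw [← natCast_val_eq_residue, ← stdAddChar_pow_mul_natCast, Nat.cast_mul, Nat.cast_pow,
    ZMod.natCast_zmod_val, mul_comm]

/-- The generators of the tiling complement: at the levels `k ≤ m` outside `S` it is the dual
`(0, p ^ (m - k))` of level `k`, and at level `m + 1` it is orthogonal to the pivot `(c, p ^ κ)`. -/
def complementGenerator (m κ : ℕ) (c : ZMod p) (k : ℕ) : ZModPair p m :=
  if k ≤ m then (0, p ^ (m - k)) else (1, -(c.val * p ^ (m - κ)))

variable {x : ZMod p} {u : ZMod (p ^ (m + 1))}

lemma isPrimitiveRoot_complementGenerator (hk : k ≤ m) (hu : residue u ≠ 0) :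
    IsPrimitiveRoot (chiHom (m := m) (x, u * p ^ k) (complementGenerator m κ c k)) p := by
  rw [complementGenerator, if_pos hk, chiHom_apply, mul_zero, AddChar.map_zero_eq_one, one_mul,
    mul_assoc, ← pow_add, Nat.add_sub_cancel' hk, stdAddChar_mul_pow]
  exact isPrimitiveRoot_stdAddChar hu

lemma isPrimitiveRoot_complementGenerator_last_of_lt (hk : κ < k ∨ m < k) (hx : x ≠ 0) :
    IsPrimitiveRoot (chiHom (m := m) (x, u * p ^ k) (complementGenerator m κ c (m + 1))) p := by
  have hzero : u * (p : ZMod (p ^ (m + 1))) ^ k * -(c.val * p ^ (m - κ)) = 0 := by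
    rw [mul_neg, mul_mul_mul_comm, ← pow_add, natCast_pow_eq_zero (by lia), mul_zero, neg_zero]
  rw [complementGenerator, if_neg (by simp), chiHom_apply, mul_one, hzero, AddChar.map_zero_eq_one,
    mul_one]
  exact isPrimitiveRoot_stdAddChar hx

lemma isPrimitiveRoot_complementGenerator_last_self (hκ : κ ≤ m) (hx : x ≠ c * residue u) :
    IsPrimitiveRoot (chiHom (m := m) (x, u * p ^ κ) (complementGenerator m κ c (m + 1))) p := by
  have hmul : u * (p : ZMod (p ^ (m + 1))) ^ κ * -(c.val * p ^ (m - κ)) = -(c.val * u) * p ^ m := by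
    rw [mul_neg, mul_mul_mul_comm, ← pow_add, Nat.add_sub_cancel' hκ, neg_mul, mul_comm u]
  rw [complementGenerator, if_neg (by simp), chiHom_apply, mul_one, hmul, stdAddChar_mul_pow,
    map_neg, map_mul, map_natCast, ZMod.natCast_zmod_val, ← AddChar.map_add_eq_mul,
    ← sub_eq_add_neg]
  exact isPrimitiveRoot_stdAddChar (sub_ne_zero.2 hx)

lemma IsDigitSystem.last_notMem (hS : IsDigitSystem A S κ c) (hA : A.Nonempty) (hκ : κ ≤ m) :
    m + 1 ∉ S := fun h =>
  zero_freq_notMem_zeroSet hA m.lt_succ_self (hS.above _ h (Nat.lt_succ_of_le hκ))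

lemma IsDigitSystem.mem_zeroSet_or_isPrimitiveRoot_of_mem (hS : IsDigitSystem A S κ c)
    (hA : A.Nonempty) (hkS : k ∈ S) (hu : residue u ≠ 0)
    (hg : ((x, u * p ^ k) : ZModPair p m) ≠ 0) :
    (x, u * p ^ k) ∈ zeroSet A ∨ m + 1 ∉ S ∧
      IsPrimitiveRoot (chiHom (m := m) (x, u * p ^ k) (complementGenerator m κ c (m + 1))) p := by
  rw [mk_mul_pow_mem_zeroSet_iff hu]
  rcases lt_trichotomy k κ with hlt | rfl | hlt
  · exact .inl (hS.below k hkS hlt _)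
  · have hpivot := hS.pivot hkS
    rcases le_or_gt k m with hk | hk
    · refine or_iff_not_imp_left.2 fun hx => ⟨hS.last_notMem hA hk,
        isPrimitiveRoot_complementGenerator_last_self hk fun hxc => hx ?_⟩
      rwa [hxc, mul_div_cancel_right₀ _ hu]
    · have hx : x ≠ 0 := by
        rintro rfl
        exact hg (by rw [natCast_pow_eq_zero hk, mul_zero]; rfl)
      have hc : c ≠ 0 := by
        rintro rfl
        exact zero_freq_notMem_zeroSet hA hk hpivot
      exact .inl ((freq_last_mem_zeroSet_iff (div_ne_zero hx hu) hc hk).2 hpivot)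
  · rcases eq_or_ne x 0 with rfl | hx
    · exact .inl (by rw [zero_div]; exact hS.above k hkS hlt)
    · have hk := mem_range.1 (hS.subset hkS)
      exact .inr ⟨hS.last_notMem hA (by lia),
        isPrimitiveRoot_complementGenerator_last_of_lt (.inl hlt) hx⟩

theorem HasDigitSystem.isTile (hA : A.Nonempty) (h : HasDigitSystem A) : IsTile A := by
  obtain ⟨S, κ, c, hS, hcard⟩ := h
  refine isTile_of_digitSum hp.out.one_lt
    (fun k : (range (m + 2) \ S : Finset ℕ) => complementGenerator m κ c k) ?_ fun ψ hψ => ?_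
  · rw [Fintype.card_coe, hcard, ← pow_add, add_comm, card_sdiff_add_card_eq_card hS.subset,
      card_range, ← Nat.card_eq_fintype_card, natCard_zModPair]
  obtain ⟨⟨x, s⟩, rfl⟩ := chiHom_surjective ψ
  obtain ⟨k, hk, u, hu, rfl⟩ := exists_eq_mul_pow s
  have hg : ((x, u * p ^ k) : ZModPair p m) ≠ 0 := fun hg => hψ (by rw [hg, map_zero])
  have hindex (j : ℕ) (hj : j ≤ m + 1) (hjS : j ∉ S)
      (hroot : IsPrimitiveRoot (chiHom (m := m) (x, u * p ^ k) (complementGenerator m κ c j)) p) :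
      ∃ l : (range (m + 2) \ S : Finset ℕ),
        IsPrimitiveRoot (chiHom (m := m) (x, u * p ^ k) (complementGenerator m κ c l)) p :=
    ⟨⟨j, mem_sdiff.2 ⟨mem_range.2 (by lia), hjS⟩⟩, hroot⟩
  by_cases hkS : k ∈ S
  · exact (hS.mem_zeroSet_or_isPrimitiveRoot_of_mem hA hkS hu hg).imp_right
      fun h => hindex _ le_rfl h.1 h.2
  refine .inr (hindex k hk hkS ?_)
  rcases hk.lt_or_eq with hk | rfl
  · exact isPrimitiveRoot_complementGenerator (by lia) hu
  · refine isPrimitiveRoot_complementGenerator_last_of_lt (.inr m.lt_succ_self) ?_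
    rintro rfl
    exact hg (by rw [natCast_pow_eq_zero m.lt_succ_self, mul_zero]; rfl)

end OfIsDigitSystem

section ZeroLevels

variable {p m : ℕ} [hp : Fact p.Prime] {A : Finset (ZModPair p m)} {k κ : ℕ} {c : ZMod p}

/-- The levels `k ≤ m` at which the Fourier transform of `A` vanishes at `(0, p ^ k)`. -/
noncomputable def zeroLevels (A : Finset (ZModPair p m)) : Finset ℕ :=
  open Classical in {k ∈ range (m + 1) | freq 0 k ∈ zeroSet A}

lemma mem_zeroLevels : k ∈ zeroLevels A ↔ k ≤ m ∧ freq 0 k ∈ zeroSet A := by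
  simp only [zeroLevels, mem_filter, mem_range, Nat.lt_succ_iff]

lemma mem_zeroLevels_of_zero_freq_mem (hA : A.Nonempty) (h : freq 0 k ∈ zeroSet A) :
    k ∈ zeroLevels A :=
  mem_zeroLevels.2 ⟨not_lt.1 fun hk => zero_freq_notMem_zeroSet hA hk h, h⟩

lemma zeroLevels_subset : zeroLevels A ⊆ range (m + 2) := fun _ hk =>
  mem_range.2 (by have := (mem_zeroLevels.1 hk).1; lia)

lemma isDigitSystem_zeroLevels : IsDigitSystem A (zeroLevels A) 0 0 where
  subset := zeroLevels_subset
  pivot_le := Nat.zero_le _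
  below _ _ hk := absurd hk (Nat.not_lt_zero _)
  pivot h := (mem_zeroLevels.1 h).2
  above _ h _ := (mem_zeroLevels.1 h).2

lemma isDigitSystem_insert_zeroLevels (hκ : κ ≤ m + 1)
    (hfull : ∀ k ∈ zeroLevels A, k < κ → IsFullLevel A k) (hc : freq c κ ∈ zeroSet A) :
    IsDigitSystem A (insert κ (zeroLevels A)) κ c where
  subset := insert_subset (mem_range.2 (by lia)) zeroLevels_subset
  pivot_le := hκ
  below k hk hlt := hfull k (mem_of_mem_insert_of_ne hk hlt.ne) hlt
  pivot _ := hc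
  above _ hk hlt := (mem_zeroLevels.1 (mem_of_mem_insert_of_ne hk hlt.ne')).2

end ZeroLevels

section OfIsSpectral

lemma card_le_card_pow_of_separates {α β ι : Type*} [Fintype β] {B : Finset α} {S : Finset ι}
    (D : ι → α → β) (h : ∀ b ∈ B, ∀ b' ∈ B, b ≠ b' → ∃ i ∈ S, D i b ≠ D i b') :
    #B ≤ Fintype.card β ^ #S := by
  classical
  have hinj : Set.InjOn (fun b (i : S) => D i b) B := by
    intro b hb b' hb' heq
    by_contra hne
    obtain ⟨i, hi, hD⟩ := h b hb b' hb' hne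
    exact hD (congr_fun heq ⟨i, hi⟩)
  simpa using card_le_card_of_injOn _ (fun _ _ => mem_coe.2 (mem_univ _)) hinj

variable {p m : ℕ} [hp : Fact p.Prime] {A : Finset (ZModPair p m)} {j k κ : ℕ}
  {u s s' : ZMod (p ^ (m + 1))}

/-- The `p`-adic digit of `s` at `p ^ j`. -/
def digit (j : ℕ) (s : ZMod (p ^ (m + 1))) : ZMod p :=
  (s.val / p ^ j : ℕ)

lemma digit_natCast (hj : j ≤ m) (N : ℕ) :
    digit j (N : ZMod (p ^ (m + 1))) = (N / p ^ j : ℕ) := by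
  have hpow : p ^ (m + 1) = p ^ j * p ^ (m + 1 - j) := by
    rw [← pow_add, Nat.add_sub_cancel' (hj.trans m.le_succ)]
  rw [digit, ZMod.val_natCast, hpow, Nat.mod_mul_right_div_self, ZMod.natCast_eq_natCast_iff]
  exact (Nat.mod_modEq _ _).of_dvd (dvd_pow_self p (by lia))

lemma digit_eq_add_of_sub_eq (hj : j ≤ m) (hjk : j ≤ k) (h : s - s' = u * p ^ k) :
    digit j s = digit j s' + residue u * p ^ (k - j) := by
  have hs : s = (s'.val + u.val * p ^ (k - j) * p ^ j : ℕ) := by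
    rw [mul_assoc, ← pow_add, Nat.sub_add_cancel hjk]
    push_cast
    rw [ZMod.natCast_zmod_val, ZMod.natCast_zmod_val, ← h, add_sub_cancel]
  rw [hs, digit_natCast hj, Nat.add_mul_div_right _ _ (pow_pos hp.out.pos j), Nat.cast_add, digit,
    ← natCast_val_eq_residue]
  push_cast
  rfl

lemma digit_eq_of_sub_eq (hj : j ≤ m) (hjk : j < k) (h : s - s' = u * p ^ k) :
    digit j s = digit j s' := by
  rw [digit_eq_add_of_sub_eq hj hjk.le h, ZMod.natCast_self,
    zero_pow (Nat.sub_ne_zero_of_lt hjk), mul_zero, add_zero]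

lemma digit_sub_digit (hk : k ≤ m) (h : s - s' = u * p ^ k) :
    digit k s - digit k s' = residue u := by
  rw [digit_eq_add_of_sub_eq hk le_rfl h, Nat.sub_self, pow_zero, mul_one, add_sub_cancel_left]

/-- Some but not all elements of level `k` are zeros of the Fourier transform of `A`. -/
def IsMixedLevel (A : Finset (ZModPair p m)) (k : ℕ) : Prop :=
  (∃ c, freq c k ∈ zeroSet A) ∧ ∃ c, freq c k ∉ zeroSet A

lemma isFullLevel_of_not_isMixedLevel {c : ZMod p} (hk : ¬ IsMixedLevel A k)
    (hc : freq c k ∈ zeroSet A) : IsFullLevel A k := fun d =>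
  not_not.1 fun hd => hk ⟨⟨c, hc⟩, d, hd⟩

/-- The digits of `b`, with the one at the pivot level `κ` replaced by a linear form in the first
coordinate and that digit. -/
def pivotDigit (κ : ℕ) (c : ZMod p) (k : ℕ) (b : ZModPair p m) : ZMod p :=
  if k = κ then b.1 - c * digit κ b.2 else digit k b.2

lemma exists_digit_ne (hA : A.Nonempty) (hnot : ∀ k ≤ m + 1, ¬ IsMixedLevel A k)
    {b b' : ZModPair p m} (hb : b - b' ∈ zeroSet A) :
    ∃ k ∈ zeroLevels A, digit k b.2 ≠ digit k b'.2 := by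
  obtain ⟨k, hk, u, hu, hs⟩ := exists_eq_mul_pow (b.2 - b'.2)
  rw [← Prod.mk.eta (p := b - b'), Prod.snd_sub, hs, mk_mul_pow_mem_zeroSet_iff hu] at hb
  have hmem := mem_zeroLevels_of_zero_freq_mem hA (isFullLevel_of_not_isMixedLevel (hnot k hk) hb 0)
  refine ⟨k, hmem, fun heq => hu ?_⟩
  rw [← digit_sub_digit (mem_zeroLevels.1 hmem).1 hs, heq, sub_self]

lemma exists_pivotDigit_ne (hA : A.Nonempty) {c : ZMod p} (hc : freq c κ ∉ zeroSet A)
    (hmin : ∀ k < κ, ¬ IsMixedLevel A k) {b b' : ZModPair p m} (hb : b - b' ∈ zeroSet A) :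
    ∃ k ∈ insert κ (zeroLevels A), pivotDigit κ c k b ≠ pivotDigit κ c k b' := by
  have hne : b ≠ b' := fun h => zero_notMem_zeroSet hA (sub_eq_zero.2 h ▸ hb)
  obtain ⟨k, hk, u, hu, hs⟩ := exists_eq_mul_pow (b.2 - b'.2)
  rw [← Prod.mk.eta (p := b - b'), Prod.fst_sub, Prod.snd_sub, hs,
    mk_mul_pow_mem_zeroSet_iff hu] at hb
  have hdigit (hkκ : k ≠ κ) (h : freq 0 k ∈ zeroSet A) :
      ∃ k ∈ insert κ (zeroLevels A), pivotDigit κ c k b ≠ pivotDigit κ c k b' := by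
    have hmem := mem_zeroLevels_of_zero_freq_mem hA h
    refine ⟨k, mem_insert_of_mem hmem, fun heq => hu ?_⟩
    rw [pivotDigit, pivotDigit, if_neg hkκ, if_neg hkκ] at heq
    rw [← digit_sub_digit (mem_zeroLevels.1 hmem).1 hs, heq, sub_self]
  have hpivot (h : b.1 - b'.1 ≠ c * (digit κ b.2 - digit κ b'.2)) :
      ∃ k ∈ insert κ (zeroLevels A), pivotDigit κ c k b ≠ pivotDigit κ c k b' := by
    refine ⟨κ, mem_insert_self _ _, fun heq => h ?_⟩
    rw [pivotDigit, pivotDigit, if_pos rfl, if_pos rfl] at heq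
    linear_combination heq
  rcases lt_trichotomy k κ with hlt | rfl | hlt
  · exact hdigit hlt.ne (isFullLevel_of_not_isMixedLevel (hmin k hlt) hb 0)
  · refine hpivot fun heq => ?_
    rcases le_or_gt k m with hkm | hkm
    · rw [heq, digit_sub_digit hkm hs, mul_div_cancel_right₀ _ hu] at hb
      exact hc hb
    · rw [natCast_pow_eq_zero hkm, mul_zero, sub_eq_zero] at hs
      rw [hs, sub_self, mul_zero, sub_eq_zero] at heq
      exact hne (Prod.ext heq hs)
  · by_cases hx : b.1 - b'.1 = 0
    · rw [hx, zero_div] at hb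
      exact hdigit hlt.ne' hb
    · refine hpivot ?_
      rwa [digit_eq_of_sub_eq (by lia) hlt hs, sub_self, mul_zero]

lemma IsDigitSystem.hasDigitSystem_of_card_le {S : Finset ℕ} {c : ZMod p}
    (hS : IsDigitSystem A S κ c) (hA : A.Nonempty) (hle : #A ≤ p ^ #S) : HasDigitSystem A :=
  ⟨S, κ, c, hS, hle.antisymm (Nat.le_of_dvd hA.card_pos hS.pow_card_dvd)⟩

theorem hasDigitSystem_of_isSpectral (hA : A.Nonempty) (h : IsSpectral p (m + 1) A) :
    HasDigitSystem A := by
  classical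
  obtain ⟨B, hcard, hB⟩ := (isSpectral_iff hA).1 h
  have hle {S : Finset ℕ} (D : ℕ → ZModPair p m → ZMod p)
      (hD : ∀ b b', b - b' ∈ zeroSet A → ∃ k ∈ S, D k b ≠ D k b') : #A ≤ p ^ #S := by
    simpa only [hcard, ZMod.card] using
      card_le_card_pow_of_separates D fun b hb b' hb' hne => hD b b' (hB b hb b' hb' hne)
  by_cases hmixed : ∃ κ ≤ m + 1, IsMixedLevel A κ
  · obtain ⟨hκ, ⟨c, hc⟩, c', hc'⟩ := Nat.find_spec hmixed
    set κ := Nat.find hmixed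
    have hmin (k : ℕ) (hk : k < κ) : ¬ IsMixedLevel A k := fun h =>
      Nat.find_min hmixed hk ⟨hk.le.trans hκ, h⟩
    have hfull (k : ℕ) (hk : k ∈ zeroLevels A) (hlt : k < κ) : IsFullLevel A k :=
      isFullLevel_of_not_isMixedLevel (hmin k hlt) (mem_zeroLevels.1 hk).2
    exact (isDigitSystem_insert_zeroLevels hκ hfull hc).hasDigitSystem_of_card_le hA
      (hle _ fun b b' => exists_pivotDigit_ne hA hc' hmin)
  · push Not at hmixed
    exact isDigitSystem_zeroLevels.hasDigitSystem_of_card_le hA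
      (hle (fun k b => digit k b.2) fun b b' => exists_digit_ne hA hmixed)

end OfIsSpectral

section OfIsTile

variable {p m : ℕ} [hp : Fact p.Prime] {A T : Finset (ZModPair p m)} {k : ℕ} {c : ZMod p}

lemma freq_ne_zero (hk : k ≤ m) : freq (m := m) c k ≠ 0 := by
  intro h
  have hpow : (p : ZMod (p ^ (m + 1))) ^ k = 0 := congr_arg Prod.snd h
  rw [← Nat.cast_pow, ZMod.natCast_eq_zero_iff, Nat.pow_dvd_pow_iff_le_right hp.out.one_lt] at hpow
  lia

lemma range_subset_zeroLevels_union (h : ∀ g ≠ 0, g ∈ zeroSet A ∨ g ∈ zeroSet T) :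
    range (m + 1) ⊆ zeroLevels A ∪ zeroLevels T := by
  intro k hk
  have hk : k ≤ m := Nat.lt_succ_iff.1 (mem_range.1 hk)
  simpa only [mem_union, mem_zeroLevels, hk, true_and] using h _ (freq_ne_zero (c := 0) hk)

lemma exists_freq_mem_zeroSet (h : ∀ g ≠ 0, g ∈ zeroSet A ∨ g ∈ zeroSet T)
    (hdisj : Disjoint (zeroLevels A) (zeroLevels T)) (hAk : ¬ IsFullLevel A k)
    (hTk : ¬ IsFullLevel T k) :
    (∃ c, freq c k ∈ zeroSet A ∧ k ∉ zeroLevels A) ∨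
      ∃ c, freq c k ∈ zeroSet T ∧ k ∉ zeroLevels T := by
  rcases le_or_gt k m with hk | hk
  · simp only [IsFullLevel, not_forall] at hAk hTk
    obtain ⟨d, hd⟩ := hAk
    obtain ⟨e, he⟩ := hTk
    by_cases hkA : k ∈ zeroLevels A
    · exact .inr ⟨d, (h _ (freq_ne_zero hk)).resolve_left hd, disjoint_left.1 hdisj hkA⟩
    · exact .inl ⟨e, (h _ (freq_ne_zero hk)).resolve_right he, hkA⟩
  · have hlast (X : Finset (ZModPair p m)) : k ∉ zeroLevels X := fun hX =>
      hk.not_ge (mem_zeroLevels.1 hX).1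
    have hne : freq (p := p) (m := m) 1 k ≠ 0 := fun h => one_ne_zero (congr_arg Prod.fst h)
    exact (h _ hne).imp (fun hA => ⟨1, hA, hlast A⟩) fun hT => ⟨1, hT, hlast T⟩

lemma exists_isDigitSystem_insert_zeroLevels (hA : A.Nonempty) (hT : T.Nonempty)
    (h : ∀ g ≠ 0, g ∈ zeroSet A ∨ g ∈ zeroSet T)
    (hdisj : Disjoint (zeroLevels A) (zeroLevels T)) :
    ∃ κ c, (κ ∉ zeroLevels A ∧ IsDigitSystem A (insert κ (zeroLevels A)) κ c) ∨
      (κ ∉ zeroLevels T ∧ IsDigitSystem T (insert κ (zeroLevels T)) κ c) := by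
  classical
  have hlast : ¬ IsFullLevel A (m + 1) ∧ ¬ IsFullLevel T (m + 1) :=
    ⟨fun h => zero_freq_notMem_zeroSet hA m.lt_succ_self (h 0),
      fun h => zero_freq_notMem_zeroSet hT m.lt_succ_self (h 0)⟩
  have hex : ∃ κ, ¬ IsFullLevel A κ ∧ ¬ IsFullLevel T κ := ⟨m + 1, hlast⟩
  obtain ⟨hAκ, hTκ⟩ := Nat.find_spec hex
  have hκ : Nat.find hex ≤ m + 1 := Nat.find_min' hex hlast
  set κ := Nat.find hex
  have hfull (k : ℕ) (hk : k < κ) : IsFullLevel A k ∨ IsFullLevel T k := by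
    simpa only [not_and_or, not_not] using Nat.find_min hex hk
  have hfullA (k : ℕ) (hkA : k ∈ zeroLevels A) (hk : k < κ) : IsFullLevel A k :=
    (hfull k hk).resolve_right fun hkT =>
      disjoint_left.1 hdisj hkA (mem_zeroLevels_of_zero_freq_mem hT (hkT 0))
  have hfullT (k : ℕ) (hkT : k ∈ zeroLevels T) (hk : k < κ) : IsFullLevel T k :=
    (hfull k hk).resolve_left fun hkA =>
      disjoint_left.1 hdisj (mem_zeroLevels_of_zero_freq_mem hA (hkA 0)) hkT
  rcases exists_freq_mem_zeroSet h hdisj hAκ hTκ with ⟨c, hc, hκA⟩ | ⟨c, hc, hκT⟩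
  · exact ⟨κ, c, .inl ⟨hκA, isDigitSystem_insert_zeroLevels hκ hfullA hc⟩⟩
  · exact ⟨κ, c, .inr ⟨hκT, isDigitSystem_insert_zeroLevels hκ hfullT hc⟩⟩

lemma IsTile.exists_zeroSet_complement (hA : IsTile A) :
    ∃ T : Finset (ZModPair p m), (∀ g ≠ 0, g ∈ zeroSet A ∨ g ∈ zeroSet T) ∧
      ∃ s t, #A = p ^ s ∧ #T = p ^ t ∧ s + t = m + 2 := by
  obtain ⟨T, hcard, hchar⟩ := hA.exists_charSum_eq_zero
  rw [← Nat.card_eq_fintype_card, natCard_zModPair] at hcard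
  obtain ⟨s, -, hs⟩ := (Nat.dvd_prime_pow hp.out).1 (Dvd.intro _ hcard)
  obtain ⟨t, -, ht⟩ := (Nat.dvd_prime_pow hp.out).1 (Dvd.intro_left _ hcard)
  refine ⟨T, fun g hg => hchar _ ((map_ne_zero_iff _ chiHom_injective).2 hg), s, t, hs, ht, ?_⟩
  rw [hs, ht, ← pow_add] at hcard
  exact Nat.pow_right_injective hp.out.two_le hcard

theorem hasDigitSystem_of_isTile (hA : A.Nonempty) (hAt : IsTile A) : HasDigitSystem A := by
  obtain ⟨T, hzero, s, t, hs, ht, hst⟩ := hAt.exists_zeroSet_complement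
  have hT : T.Nonempty := card_pos.1 (ht ▸ pow_pos hp.out.pos t)
  have hleA := isDigitSystem_zeroLevels.card_le_of_card_eq_pow hs
  have hleT := isDigitSystem_zeroLevels.card_le_of_card_eq_pow ht
  have hunion : m + 1 ≤ #(zeroLevels A ∪ zeroLevels T) := by
    simpa only [card_range] using card_le_card (range_subset_zeroLevels_union hzero)
  have hadd := card_union_add_card_inter (zeroLevels A) (zeroLevels T)
  rcases hleA.eq_or_lt with heq | hlt
  · exact ⟨zeroLevels A, 0, 0, isDigitSystem_zeroLevels, by rw [hs, heq]⟩
  have hdisj : Disjoint (zeroLevels A) (zeroLevels T) := by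
    rw [disjoint_iff_inter_eq_empty, ← card_eq_zero]
    lia
  obtain ⟨κ, c, ⟨hκ, hS⟩ | ⟨hκ, hS⟩⟩ := exists_isDigitSystem_insert_zeroLevels hA hT hzero hdisj
  · refine ⟨_, κ, c, hS, ?_⟩
    rw [hs, card_insert_of_notMem hκ]
    congr 1
    lia
  · have hle := hS.card_le_of_card_eq_pow ht
    rw [card_insert_of_notMem hκ] at hle
    lia

end OfIsTile

theorem theorem1p1 (p n : ℕ) [Fact p.Prime] (hn : 0 < n)
    (A : Finset (ZMod p × ZMod (p ^ n))) (hA : A.Nonempty) :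
    IsSpectral p n A ↔ IsTile A := by
  obtain ⟨m, rfl⟩ : ∃ m, n = m + 1 := Nat.exists_eq_add_one.2 hn
  exact ⟨fun h => (hasDigitSystem_of_isSpectral hA h).isTile hA,
    fun h => (hasDigitSystem_of_isTile hA h).isSpectral hA⟩
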